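/- Let $S$ be a normal integral scheme and let $A$ be an $n$-dimensional $\mathbb{G}_{a,S}$-algebra scheme, i.e. a (unitary, associative, not necessarily commutative) ring scheme over $S$ with a central homomorphism of ring schemes $\mathbb{G}_{a,S}\to A$, whose underlying $\mathbb{G}_{a,S}$-module scheme is a vector bundle of rank $n$. Let $d$ be the least integer such that the morphism $A\to\wedge^{d+1}A$, $a\mapsto 1\wedge a\wedge\dots\wedge a^d$, is zero, and assume $d\ge 2$. Let $\det=\det_{A/S}$ be the determinant of $A$, i.e. the section of $\mathrm{Sym}^d(A^\vee)$ (viewed as a function $A\to\mathbb{G}_{a,S}$) such that (1) $\det\colon A\to\mathbb{G}_{a,S}$ is a morphism of multiplicative unitary monoid schemes, and (2) the morphism of schemes $A\to A$ obtained by evaluating at $a\in A$ the polynomial $P(T)=\det(T-a)$ is zero. Let $f\colon A\to A$ be a morphism of $S$-schemes that is either a ring scheme automorphism or a ring scheme antiautomorphism (not assumed to be $\mathbb{G}_{a,S}$-linear). (a) If $f$ takes the scalars to the scalars, i.e. $f(\mathbb{G}_{a,S})=\mathbb{G}_{a,S}$ for the image $\mathbb{G}_{a,S}\subset A$ of the structure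 homomorphism, then $\det_{A/S}\circ f=f\circ\det_{A/S}$, as morphisms $A\to\mathbb{G}_{a,S}\subset A$. (b) In particular, if $f$ is a $\mathbb{G}_{a,S}$-algebra automorphism or antiautomorphism, i.e. $f$ is moreover $\mathbb{G}_{a,S}$-linear, then $\det_{A/S}\circ f=\det_{A/S}$. -/

import Mathlib

open AlgebraicGeometry CategoryTheory
open scoped RingObj

universe u

namespace AlgScheme

variable {S : Scheme.{u}}

/-- The structure of an algebra over the ring scheme `𝔾ₐ` over `S` on a (not necessarily
commutative) ring scheme `A` over `S`, i.e. a central homomorphism of ring schemes `𝔾ₐ → A`.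
The `T`-points of `𝔾ₐ` are the global functions `Γ(T, ⊤)` on `T`, and the homomorphism is given
through Yoneda by its effect on `T`-points, naturally in the `S`-scheme `T`. -/
class GaAlgebra (A : Over S) [RingObj A] where
  /-- The scalars of `A(T)`. -/
  scalar (T : Over S) : Γ(T.left, ⊤) →+* (T ⟶ A)
  comp_scalar {T T' : Over S} (g : T' ⟶ T) (r : Γ(T.left, ⊤)) :
    g ≫ scalar T r = scalar T' (g.left.appTop r)
  scalar_comm (T : Over S) (r : Γ(T.left, ⊤)) (a : T ⟶ A) : scalar T r * a = a * scalar T r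

/-- The set `A(T)` of `T`-points is an algebra over the ring `Γ(T, ⊤)`. -/
noncomputable instance (A : Over S) [RingObj A] [GaAlgebra A] (T : Over S) :
    Algebra Γ(T.left, ⊤) (T ⟶ A) :=
  (GaAlgebra.scalar T).toAlgebra' (GaAlgebra.scalar_comm T)

variable (A : Over S) [RingObj A] [GaAlgebra A]

/-- Sections `e₁, …, eₙ` of `A` over an open subscheme `U` of `S` form a frame if
`(c₁, …, cₙ) ↦ c₁ e₁ + ⋯ + cₙ eₙ` is an isomorphism from `𝔾ₐⁿ` over `U` to `A` restricted to `U`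
(checked on `T`-points for all `T` over `U`). -/
def IsFrame {n : ℕ} (U : S.Opens) (e : Fin n → (Over.mk U.ι ⟶ A)) : Prop :=
  ∀ (T : Over S) (g : T ⟶ Over.mk U.ι),
    Function.Bijective fun c : Fin n → Γ(T.left, ⊤) ↦ ∑ i, c i • (g ≫ e i)

/-- The `𝔾ₐ`-module scheme underlying `A` is a vector bundle of rank `n` over `S`. -/
def IsVectorBundle (n : ℕ) : Prop :=
  ∀ x : S, ∃ U : S.Opens, x ∈ U ∧ ∃ e : Fin n → (Over.mk U.ι ⟶ A), IsFrame A U e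

/-- The morphism `A → ⋀^{d+1} A`, `a ↦ 1 ∧ a ∧ ⋯ ∧ a ^ d`, is zero. It suffices to consider points
with values in affine schemes `T` over `S`, for which the `T`-points of `⋀^{d+1} A` are the
elements of the exterior power of the `Γ(T, ⊤)`-module `A(T)`. -/
def DegreeLE (d : ℕ) : Prop :=
  ∀ (T : Over S) [IsAffine T.left] (a : T ⟶ A),
    exteriorPower.ιMulti Γ(T.left, ⊤) (d + 1) (fun i : Fin (d + 1) ↦ a ^ (i : ℕ)) = 0

variable {A}

/-- The value `δ(a) ∈ Γ(T, ⊤) = 𝔾ₐ(T)` at a point `a ∈ A(T)` of a global function `δ` on `A`. -/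
noncomputable def value (δ : Γ(A.left, ⊤)) {T : Over S} (a : T ⟶ A) : Γ(T.left, ⊤) :=
  a.left.appTop δ

/-- The function `δ` on `A` is a section of `Sym^d (A^∨)` over `S`: in terms of every local frame
it is a homogeneous polynomial of degree `d` in the coordinates, with coefficients functions on
the base. -/
def IsSymSection (n d : ℕ) (δ : Γ(A.left, ⊤)) : Prop :=
  ∀ (U : S.Opens) (e : Fin n → (Over.mk U.ι ⟶ A)), IsFrame A U e →
    ∃ P : MvPolynomial (Fin n) Γ((Over.mk U.ι).left, ⊤), P.IsHomogeneous d ∧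
      ∀ (T : Over S) (g : T ⟶ Over.mk U.ι) (c : Fin n → Γ(T.left, ⊤)),
        value δ (∑ i, c i • (g ≫ e i)) = P.eval₂ g.left.appTop.hom c

open scoped Polynomial

/-- The affine line over an affine `S`-scheme `T`, i.e. the spectrum of `Γ(T, ⊤)[X]`, as an
`S`-scheme. -/
noncomputable abbrev line (T : Over S) [IsAffine T.left] : Over S :=
  Over.mk (Spec.map (CommRingCat.ofHom (Polynomial.C (R := Γ(T.left, ⊤)))) ≫
    T.left.isoSpec.inv ≫ T.hom)

/-- The projection of the affine line over `T` to `T`. -/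
noncomputable def lineProj (T : Over S) [IsAffine T.left] : line T ⟶ T :=
  Over.homMk (Spec.map (CommRingCat.ofHom (Polynomial.C (R := Γ(T.left, ⊤)))) ≫
    T.left.isoSpec.inv) (by simp)

/-- The ring of functions of the affine line over `T` is `Γ(T, ⊤)[X]`. -/
noncomputable def lineFunctions (T : Over S) [IsAffine T.left] :
    Γ((line T).left, ⊤) ≃+* Γ(T.left, ⊤)[X] :=
  (Scheme.ΓSpecIso (CommRingCat.of Γ(T.left, ⊤)[X])).commRingCatIsoToRingEquiv

/-- The polynomial `δ(X - a)` in the indeterminate `X`, for a point `a ∈ A(T)`, where `T` is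
affine: the value of `δ` at the point `X - a` of `A` with values in the affine line over `T`. -/
noncomputable def charPoly (δ : Γ(A.left, ⊤)) {T : Over S} [IsAffine T.left] (a : T ⟶ A) :
    Γ(T.left, ⊤)[X] :=
  lineFunctions T
    (value δ (algebraMap _ (line T ⟶ A) ((lineFunctions T).symm Polynomial.X) - lineProj T ≫ a))

/-- The function `δ` is a determinant of the `n`-dimensional algebra scheme `A` of degree `d`: it
is a section of `Sym^d (A^∨)`, it is a homomorphism of multiplicative unitary monoid schemes
`A → 𝔾ₐ`, and the morphism `A → A` obtained by evaluating at `a` the polynomial `δ(X - a)` is zero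
(it suffices to check this on points `a` with values in affine schemes). -/
structure IsDeterminant (n d : ℕ) (δ : Γ(A.left, ⊤)) : Prop where
  isSymSection : IsSymSection n d δ
  value_one (T : Over S) : value δ (1 : T ⟶ A) = 1
  value_mul (T : Over S) (a b : T ⟶ A) : value δ (a * b) = value δ a * value δ b
  aeval_charPoly (T : Over S) [IsAffine T.left] (a : T ⟶ A) :
    Polynomial.aeval a (charPoly δ a) = 0

/-- A ring scheme automorphism. It need not be linear over `𝔾ₐ`. -/
structure IsRingAut (f : A ⟶ A) : Prop where
  isIso : IsIso f
  isRingHom : IsRingHom f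

/-- A ring scheme antiautomorphism. It need not be linear over `𝔾ₐ`. -/
structure IsRingAntiaut (f : A ⟶ A) : Prop where
  isIso : IsIso f
  isAddMonHom : IsAddMonHom f
  one_comp (T : Over S) : (1 : T ⟶ A) ≫ f = 1
  mul_comp (T : Over S) (a b : T ⟶ A) : (a * b) ≫ f = (b ≫ f) * (a ≫ f)

/-- The condition `f(𝔾ₐ) = 𝔾ₐ`: the isomorphism `f` takes the scalars onto the scalars. -/
def PreservesScalars (f : A ⟶ A) : Prop :=
  ∀ T : Over S, (· ≫ f) '' Set.range (algebraMap Γ(T.left, ⊤) (T ⟶ A)) =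
    Set.range (algebraMap Γ(T.left, ⊤) (T ⟶ A))

/-- `f` is linear over `𝔾ₐ`, i.e. commutes with multiplication by scalars. -/
def IsGaLinear (f : A ⟶ A) : Prop :=
  ∀ (T : Over S) (r : Γ(T.left, ⊤)) (a : T ⟶ A), (r • a) ≫ f = r • (a ≫ f)

end AlgScheme

/-!
The theorem rests on two facts, valid over any integral base `S`.

*The determinant is unique* (`IsDeterminant.value_eq_value`). Over an affine chart of `S` on which
`A` is free, let `a` be the generic point of `A`, whose coordinates are independent variables. For
a determinant `δ` of degree `d`, the polynomial `δ(X - a)` is monic of degree `d`, because `δ` is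
homogeneous of degree `d` with `δ(1) = 1`, and it kills `a`. By minimality of `d`, the powers
`1, a, …, a ^ (d - 1)` are linearly independent (`powersWedge_genericPoint_ne_zero`), so `a` is a
root of only one such polynomial; its constant term determines `δ`. If `f` is a `𝔾ₐ`-linear
automorphism or antiautomorphism, then `det ∘ f` is again a determinant
(`IsAutOrAntiaut.isDeterminant_appTop`), so it is equal to `det`.

*The only automorphism of the ring scheme `𝔾ₐ` is the identity* (`eq_X_of_multiplicative`). So an
automorphism `f` of `A` that takes the scalars onto the scalars fixes them, and therefore is
`𝔾ₐ`-linear (`IsAutOrAntiaut.isGaLinear`).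

The minimality of `d` refers to points of `A` with values in arbitrary affine schemes `T`, where
`A(T)` need not be free. To relate it to the generic point one needs that the vanishing of
`1 ∧ a ∧ ⋯ ∧ a ^ (d - 1)` is local on `T` (`powersWedge_eq_zero_of_local`). This follows by gluing
from the description of `A(T) → A(D(h))` as a localization, which is elementary for free modules.
-/

namespace AlgScheme

open scoped Polynomial

/-! ### Open subschemes over the base -/

section Restrict

variable {S : Scheme.{u}}

/-- The open subscheme `V` of the `S`-scheme `T`, as an `S`-scheme. -/
abbrev restrict (T : Over S) (V : T.left.Opens) : Over S := Over.mk (V.ι ≫ T.hom)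

/-- The inclusion of an open subscheme of `T` into `T`, over `S`. -/
abbrev restrictι (T : Over S) (V : T.left.Opens) : restrict T V ⟶ T := Over.homMk V.ι

/-- The inclusion of nested open subschemes of `T`, over `S`. -/
noncomputable abbrev restrictLE (T : Over S) {V W : T.left.Opens} (h : V ≤ W) :
    restrict T V ⟶ restrict T W :=
  Over.homMk (T.left.homOfLE h)

@[simp]
lemma restrictLE_restrictι (T : Over S) {V W : T.left.Opens} (h : V ≤ W) :
    restrictLE T h ≫ restrictι T W = restrictι T V := by
  ext1; simp

@[simp]
lemma restrictLE_restrictLE (T : Over S) {U V W : T.left.Opens} (h : U ≤ V) (h' : V ≤ W) :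
    restrictLE T h ≫ restrictLE T h' = restrictLE T (h.trans h') := by
  ext1; simp

lemma restrictLE_restrictι_assoc (T : Over S) {V W : T.left.Opens} (h : V ≤ W) {X : Over S}
    (a : T ⟶ X) : restrictLE T h ≫ restrictι T W ≫ a = restrictι T V ≫ a := by
  rw [← Category.assoc, restrictLE_restrictι]

lemma restrictLE_restrictLE_assoc (T : Over S) {U V W : T.left.Opens} (h : U ≤ V) (h' : V ≤ W)
    {X : Over S} (a : restrict T W ⟶ X) :
    restrictLE T h ≫ restrictLE T h' ≫ a = restrictLE T (h.trans h') ≫ a := by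
  rw [← Category.assoc, restrictLE_restrictLE]

lemma restrictLE_appTop_restrictι {T : Over S} {V W : T.left.Opens} (le : V ≤ W)
    (h : Γ(T.left, ⊤)) :
    (restrictLE T le).left.appTop ((restrictι T W).left.appTop h) =
      (restrictι T V).left.appTop h := by
  rw [← restrictLE_restrictι T le, Over.comp_left, Scheme.Hom.comp_appTop,
    CommRingCat.comp_apply]

lemma exists_lift_restrict {T T' : Over S} (g : T' ⟶ T) (V : T.left.Opens)
    (hg : ∀ x, g.left x ∈ V) : ∃ q : T' ⟶ restrict T V, q ≫ restrictι T V = g :=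
  ⟨Over.homMk (IsOpenImmersion.lift V.ι g.left (by
      rw [Scheme.Opens.range_ι]
      rintro _ ⟨y, rfl⟩
      exact hg y)) (by
        simp), by ext1; exact IsOpenImmersion.lift_fac _ _ _⟩

lemma exists_restrict_preimage (T : Over S) (U : S.Opens) :
    Nonempty (restrict T (T.hom ⁻¹ᵁ U) ⟶ Over.mk U.ι) :=
  ⟨Over.homMk (T.hom ∣_ U) (by simp)⟩

lemma hom_ext_of_cover {T A : Over S} {ι : Type*} (V : ι → T.left.Opens)
    (hV : ⨆ i, V i = ⊤) {a b : T ⟶ A} (h : ∀ i, restrictι T (V i) ≫ a = restrictι T (V i) ≫ b) :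
    a = b := by
  ext1
  refine Scheme.hom_ext_of_forall _ _ fun x ↦ ?_
  obtain ⟨i, hi⟩ := TopologicalSpace.Opens.mem_iSup.1
    (hV ▸ TopologicalSpace.Opens.mem_top x : x ∈ ⨆ i, V i)
  exact ⟨V i, hi, by simpa using congr(($(h i)).left)⟩

/-- Morphisms over `S` on the members of an open cover that agree on overlaps glue. -/
lemma exists_glue {T A : Over S} {ι : Type u} (V : ι → T.left.Opens)
    (hV : ⨆ i, V i = ⊤) (y : ∀ i, restrict T (V i) ⟶ A)
    (hy : ∀ i j, restrictLE T inf_le_left ≫ y i =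
      restrictLE T (inf_le_right : V i ⊓ V j ≤ V j) ≫ y j) :
    ∃ x : T ⟶ A, ∀ i, restrictι T (V i) ≫ x = y i := by
  let 𝒰 := T.left.openCoverOfIsOpenCover V (.mk hV)
  have hy' : ∀ i j : ι, Limits.pullback.fst (V i).ι (V j).ι ≫ (y i).left =
      Limits.pullback.snd (V i).ι (V j).ι ≫ (y j).left := fun i j ↦ by
    rw [← cancel_epi (isPullback_opens_inf (V i) (V j)).isoPullback.hom]
    simpa using congr(($(hy i j)).left)
  have key : ∀ i : ι, (V i).ι ≫ 𝒰.glueMorphisms (fun i : ι ↦ (y i).left) hy' = (y i).left :=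
    fun i ↦ 𝒰.ι_glueMorphisms _ _ i
  refine ⟨Over.homMk (𝒰.glueMorphisms (fun i : ι ↦ (y i).left) hy') ?_, fun i ↦ ?_⟩
  · refine Scheme.Cover.hom_ext 𝒰 _ _ fun (i : ι) ↦ ?_
    have := Over.w (y i)
    dsimp at this
    change (V i).ι ≫ _ ≫ _ = (V i).ι ≫ _
    rw [reassoc_of% key i]
    exact this
  · ext1; exact key i

/-- On an affine open `W`, restriction of functions to `W ∩ D(h)` is localization away from `h`. -/
lemma restrict_isLocalization {T : Over S} (h : Γ(T.left, ⊤)) {V W : T.left.Opens}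
    (hW : IsAffineOpen W) (hV : V = W ⊓ T.left.basicOpen h) (le : V ≤ W) :
    letI := (restrictLE T le).left.appTop.hom.toAlgebra
    IsLocalization.Away ((restrictι T W).left.appTop h) Γ((restrict T V).left, ⊤) := by
  have hW' : IsAffineOpen (W.ι ''ᵁ ⊤) := by simpa
  have := hW'.isLocalization_of_eq_basicOpen (V := V.ι ''ᵁ ⊤)
    ((restrictι T W).left.appTop h) (homOfLE (by simpa)) (by
      have := T.left.basicOpen_res h (U := ⊤) (homOfLE (le_top : W.ι ''ᵁ ⊤ ≤ ⊤)).op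
      have h1 : V.ι ''ᵁ ⊤ = W.ι ''ᵁ ⊤ ⊓ T.left.basicOpen h := by simpa using hV
      exact h1.trans this.symm)
  rw [show (restrictLE T le).left.appTop = _ from Scheme.homOfLE_appTop le]
  exact this

lemma exists_pow_mul_eq_zero {T : Over S} {h : Γ(T.left, ⊤)} {V W : T.left.Opens}
    (hW : IsAffineOpen W) (hV : V = W ⊓ T.left.basicOpen h) (le : V ≤ W)
    {r : Γ((restrict T W).left, ⊤)} (hr : (restrictLE T le).left.appTop r = 0) :
    ∃ N : ℕ, (restrictι T W).left.appTop h ^ N * r = 0 := by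
  let := (restrictLE T le).left.appTop.hom.toAlgebra
  have := restrict_isLocalization h hW hV le
  obtain ⟨⟨_, N, rfl⟩, hN⟩ := (IsLocalization.map_eq_zero_iff
    (.powers ((restrictι T W).left.appTop h)) Γ((restrict T V).left, ⊤) r).1 hr
  exact ⟨N, hN⟩

lemma exists_restrict_eq_pow_mul {T : Over S} {h : Γ(T.left, ⊤)} {V W : T.left.Opens}
    (hW : IsAffineOpen W) (hV : V = W ⊓ T.left.basicOpen h) (le : V ≤ W)
    (s : Γ((restrict T V).left, ⊤)) :
    ∃ (N : ℕ) (r : Γ((restrict T W).left, ⊤)), (restrictLE T le).left.appTop r =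
      (restrictι T V).left.appTop h ^ N * s := by
  let := (restrictLE T le).left.appTop.hom.toAlgebra
  have := restrict_isLocalization h hW hV le
  obtain ⟨⟨r, ⟨_, N, rfl⟩⟩, hN⟩ := IsLocalization.surj
    (.powers ((restrictι T W).left.appTop h)) s
  refine ⟨N, r, hN.symm.trans ?_⟩
  rw [mul_comm, map_pow, ← restrictLE_restrictι T le, Over.comp_left, Scheme.Hom.comp_appTop,
    CommRingCat.comp_apply]
  rfl

end Restrict

/-! ### Points of the algebra scheme and frames -/

section Points

variable {S : Scheme.{u}} {A : Over S}

lemma value_comp (δ : Γ(A.left, ⊤)) {T T' : Over S} (g : T' ⟶ T) (a : T ⟶ A) :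
    value δ (g ≫ a) = g.left.appTop (value δ a) := by
  simp only [value, Over.comp_left, Scheme.Hom.comp_appTop, CommRingCat.comp_apply]

lemma value_appTop (f : A ⟶ A) (δ : Γ(A.left, ⊤)) {T : Over S} (a : T ⟶ A) :
    value (f.left.appTop δ) a = value δ (a ≫ f) := by
  simp only [value, Over.comp_left, Scheme.Hom.comp_appTop, CommRingCat.comp_apply]

variable [RingObj A]

/-- Pullback of points along `g`, as a ring homomorphism `A(T) → A(T')`. -/
def pullbackPoint {T T' : Over S} (g : T' ⟶ T) : (T ⟶ A) →+* (T' ⟶ A) where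
  toFun a := g ≫ a
  map_one' := MonObj.comp_one _
  map_zero' := AddMonObj.comp_zero _
  map_mul' _ _ := MonObj.comp_mul _ _ _
  map_add' _ _ := AddMonObj.comp_add _ _ _

@[simp]
lemma pullbackPoint_apply {T T' : Over S} (g : T' ⟶ T) (a : T ⟶ A) :
    pullbackPoint g a = g ≫ a := rfl

lemma comp_sum {T T' : Over S} (g : T' ⟶ T) {ι : Type*} (s : Finset ι) (a : ι → (T ⟶ A)) :
    g ≫ (∑ i ∈ s, a i) = ∑ i ∈ s, g ≫ a i :=
  map_sum (pullbackPoint g) a s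

variable [GaAlgebra A]

lemma comp_algebraMap {T T' : Over S} (g : T' ⟶ T) (r : Γ(T.left, ⊤)) :
    g ≫ algebraMap Γ(T.left, ⊤) (T ⟶ A) r = algebraMap _ (T' ⟶ A) (g.left.appTop r) :=
  GaAlgebra.comp_scalar g r

lemma comp_smul {T T' : Over S} (g : T' ⟶ T) (r : Γ(T.left, ⊤)) (a : T ⟶ A) :
    g ≫ (r • a) = g.left.appTop r • (g ≫ a) := by
  rw [Algebra.smul_def, Algebra.smul_def, MonObj.comp_mul, comp_algebraMap]

variable (A) in
/-- The points `e₁, …, eₙ` of `A(T)` form a frame over the `S`-scheme `T`: they are a basis of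
`A(T')` for every `T'` over `T`. For `T` an open subscheme of `S` this is `IsFrame`; stating it for
all `T` makes it stable under base change. -/
def IsFrameOver {n : ℕ} (T : Over S) (e : Fin n → (T ⟶ A)) : Prop :=
  ∀ (T' : Over S) (g : T' ⟶ T),
    Function.Bijective fun c : Fin n → Γ(T'.left, ⊤) ↦ ∑ i, c i • (g ≫ e i)

lemma IsFrameOver.comp {n : ℕ} {T : Over S} {e : Fin n → (T ⟶ A)} (h : IsFrameOver A T e)
    {T' : Over S} (g : T' ⟶ T) : IsFrameOver A T' (fun i ↦ g ≫ e i) := by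
  intro T'' g'
  simpa using h T'' (g' ≫ g)

/-- The basis of the `Γ(T, ⊤)`-module `A(T)` given by a frame over `T`. -/
noncomputable def IsFrameOver.basis {n : ℕ} {T : Over S} {e : Fin n → (T ⟶ A)}
    (h : IsFrameOver A T e) : Module.Basis (Fin n) Γ(T.left, ⊤) (T ⟶ A) :=
  Module.Basis.ofEquivFun (LinearEquiv.ofBijective
    (Fintype.linearCombination Γ(T.left, ⊤) e) (by
      convert h T (𝟙 T) using 1; ext; simp [Fintype.linearCombination_apply])).symm

@[simp]
lemma IsFrameOver.basis_apply {n : ℕ} {T : Over S} {e : Fin n → (T ⟶ A)}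
    (h : IsFrameOver A T e) (i : Fin n) : h.basis i = e i := by
  simp [IsFrameOver.basis]

lemma IsFrameOver.basis_repr_comp {n : ℕ} {T T' : Over S} {e : Fin n → (T ⟶ A)}
    (h : IsFrameOver A T e) (g : T' ⟶ T) (a : T ⟶ A) (i : Fin n) :
    (h.comp g).basis.repr (g ≫ a) i = g.left.appTop (h.basis.repr a i) := by
  have : g ≫ a = ∑ i, g.left.appTop (h.basis.repr a i) • (h.comp g).basis i := by
    conv_lhs => rw [← h.basis.sum_repr a, comp_sum]
    simp [comp_smul]
  rw [this, Module.Basis.repr_sum_self]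

end Points

/-! ### Vanishing of exterior products -/

section ExteriorPower

open exteriorPower Set

variable {R R' M M' : Type*} [CommRing R] [CommRing R'] [AddCommGroup M] [AddCommGroup M']
  [Module R M] [Module R' M'] {φ : R →+* R'} {d n : ℕ}

/-- Vanishing of an exterior product is preserved by semilinear maps, in particular by base change.
-/
lemma ιMulti_semilinear_eq_zero (f : M →ₛₗ[φ] M') {v : Fin d → M} (hv : ιMulti R d v = 0) :
    ιMulti R' d (fun i ↦ f (v i)) = 0 := by
  let := Module.compHom (⋀[R']^d M') φ
  let g : M [⋀^Fin d]→ₗ[R] (⋀[R']^d M') :=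
    { toFun := fun v ↦ ιMulti R' d (fun i ↦ f (v i))
      map_update_add' := fun v i x y ↦ by
        simp only [← Function.comp_def f, Function.comp_update, map_add,
          AlternatingMap.map_update_add]
      map_update_smul' := fun v i c x ↦ by
        simp only [← Function.comp_def f, Function.comp_update, map_smulₛₗ,
          AlternatingMap.map_update_smul]
        rfl
      map_eq_zero_of_eq' := fun v i j h hij ↦
        (ιMulti R' d).map_eq_zero_of_eq _ (by simp [h]) hij }
  have := alternatingMapLinearEquiv_apply_ιMulti g v
  rw [hv, map_zero] at this
  exact this.symm

lemma ιMulti_eq_zero_iff_minors (b : Module.Basis (Fin n) R M) (v : Fin d → M) :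
    ιMulti R d v = 0 ↔ ∀ s : powersetCard (Fin n) d,
      (Matrix.of fun i j ↦ b.repr (v i) (powersetCard.ofFinEmbEquiv.symm s j)).det = 0 := by
  rw [← (b.exteriorPower d).repr.map_eq_zero_iff, Finsupp.ext_iff]
  refine forall_congr' fun s ↦ ?_
  rw [basis_repr_apply, ιMultiDual_apply_ιMulti]
  rfl

lemma smul_ιMulti_eq_zero_iff_minors (b : Module.Basis (Fin n) R M) (v : Fin d → M) (r : R) :
    r • ιMulti R d v = 0 ↔ ∀ s : powersetCard (Fin n) d,
      r * (Matrix.of fun i j ↦ b.repr (v i) (powersetCard.ofFinEmbEquiv.symm s j)).det = 0 := by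
  rw [← (b.exteriorPower d).repr.map_eq_zero_iff, Finsupp.ext_iff]
  refine forall_congr' fun s ↦ ?_
  rw [map_smul, Finsupp.smul_apply, basis_repr_apply, ιMultiDual_apply_ιMulti]
  rfl

/-- For free modules, nonvanishing of an exterior product is preserved by injective base change. -/
lemma ιMulti_eq_zero_of_semilinear (f : M →ₛₗ[φ] M') (hφ : Function.Injective φ)
    (b : Module.Basis (Fin n) R M) (b' : Module.Basis (Fin n) R' M')
    (hb : ∀ m i, b'.repr (f m) i = φ (b.repr m i)) {v : Fin d → M}
    (hv : ιMulti R' d (fun i ↦ f (v i)) = 0) : ιMulti R d v = 0 := by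
  rw [ιMulti_eq_zero_iff_minors b]
  rw [ιMulti_eq_zero_iff_minors b'] at hv
  intro s
  apply hφ
  rw [map_zero, ← hv s, RingHom.map_det]
  congr 1
  ext i j
  simp [hb]

/-- Over a domain, a nonzero maximal minor forces the vectors to be linearly independent. -/
lemma linearIndependent_of_ιMulti_ne_zero [IsDomain R] (b : Module.Basis (Fin n) R M)
    {v : Fin d → M} (hv : ιMulti R d v ≠ 0) : LinearIndependent R v := by
  rw [Ne, ιMulti_eq_zero_iff_minors b] at hv
  push Not at hv
  obtain ⟨s, hs⟩ := hv
  rw [Fintype.linearIndependent_iff]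
  intro g hg
  refine congrFun (Matrix.eq_zero_of_vecMul_eq_zero hs (v := g) ?_)
  ext j
  have := congr(b.repr $hg (powersetCard.ofFinEmbEquiv.symm s j))
  simpa [Matrix.vecMul, dotProduct, Finsupp.finsetSum_apply] using this

open Filter in
/-- Let `f : M → M'` behave like the localization of `M` away from `h`, with `M'` free of finite
rank. If an exterior product of elements of `M` vanishes after applying `f`, it is killed by a
power of `h`. The hypotheses say that `φ` and `f` have `h`-power torsion kernels, and that their
images contain every element up to a power of `h`. -/
lemma exists_pow_smul_ιMulti_eq_zero (f : M →ₛₗ[φ] M') (h : R)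
    (hR : ∀ r, φ r = 0 → ∃ N : ℕ, h ^ N * r = 0)
    (hR' : ∀ s, ∃ (N : ℕ) (r : R), φ r = φ h ^ N * s)
    (hM : ∀ m, f m = 0 → ∃ N : ℕ, h ^ N • m = 0)
    (hM' : ∀ m', ∃ (N : ℕ) (m : M), f m = φ h ^ N • m')
    (b : Module.Basis (Fin n) R' M') {v : Fin d → M}
    (hv : ιMulti R' d (fun i ↦ f (v i)) = 0) : ∃ N : ℕ, h ^ N • ιMulti R d v = 0 := by
  have eR : ∀ r, φ r = 0 → ∀ᶠ N : ℕ in atTop, h ^ N * r = 0 := fun r hr ↦ by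
    obtain ⟨N, hN⟩ := hR r hr
    filter_upwards [eventually_ge_atTop N] with K hK
    rw [← Nat.sub_add_cancel hK, pow_add, mul_assoc, hN, mul_zero]
  have eM : ∀ m, f m = 0 → ∀ᶠ N : ℕ in atTop, h ^ N • m = 0 := fun r hr ↦ by
    obtain ⟨N, hN⟩ := hM r hr
    filter_upwards [eventually_ge_atTop N] with K hK
    rw [← Nat.sub_add_cancel hK, pow_add, mul_smul, hN, smul_zero]
  have eR' : ∀ s, ∀ᶠ N : ℕ in atTop, ∃ r : R, φ r = φ h ^ N * s := fun s ↦ by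
    obtain ⟨N, r, hN⟩ := hR' s
    filter_upwards [eventually_ge_atTop N] with K hK
    refine ⟨h ^ (K - N) * r, ?_⟩
    rw [map_mul, map_pow, hN, ← mul_assoc, ← pow_add, Nat.sub_add_cancel hK]
  have eM' : ∀ m', ∀ᶠ N : ℕ in atTop, ∃ m : M, f m = φ h ^ N • m' := fun s ↦ by
    obtain ⟨N, r, hN⟩ := hM' s
    filter_upwards [eventually_ge_atTop N] with K hK
    refine ⟨h ^ (K - N) • r, ?_⟩
    rw [map_smulₛₗ, map_pow, hN, smul_smul, ← pow_add, Nat.sub_add_cancel hK]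
  -- Lift the basis of `M'` to elements `E j` of `M`, and the coordinates of the `f (v k)` to
  -- elements `C k j` of `R`, up to powers of `h`.
  obtain ⟨N₁, h₁⟩ := (eventually_all.2 fun j ↦ eM' (b j)).exists
  choose E hE using h₁
  obtain ⟨N₂, h₂⟩ := (eventually_all.2 fun k ↦ eventually_all.2 fun j ↦
    eR' (b.repr (f (v k)) j)).exists
  choose C hC using h₂
  -- A power of `h` times `v k` is the combination of the `E j` with coefficients `C k j`.
  obtain ⟨N₃, h₃⟩ := (eventually_all.2 fun k ↦
    eM (h ^ (N₁ + N₂) • v k - ∑ j, C k j • E j) (by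
      conv_lhs => rw [map_sub, map_smulₛₗ, map_sum, ← b.sum_repr (f (v k)), Finset.smul_sum]
      rw [sub_eq_zero]
      refine Finset.sum_congr rfl fun j _ ↦ ?_
      rw [map_smulₛₗ, hE, hC, smul_smul, smul_smul, map_pow]
      congr 1
      ring)).exists
  -- The minors of `C` vanish over `R'`, so they are killed by a power of `h`.
  have h₄ : ∀ᶠ N : ℕ in atTop, ∀ s : powersetCard (Fin n) d, h ^ N *
      (Matrix.of fun i j ↦ C i (powersetCard.ofFinEmbEquiv.symm s j)).det = 0 := by
    refine eventually_all.2 fun s ↦ eR _ ?_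
    have : φ.mapMatrix (Matrix.of fun i j ↦ C i (powersetCard.ofFinEmbEquiv.symm s j)) =
        φ h ^ N₂ • Matrix.of fun i j ↦
          b.repr (f (v i)) (powersetCard.ofFinEmbEquiv.symm s j) := by
      ext i j
      simp [hC]
    rw [RingHom.map_det, this, Matrix.det_smul, (ιMulti_eq_zero_iff_minors b _).1 hv s, mul_zero]
  obtain ⟨N₄, h₄⟩ := h₄.exists
  -- Hence the rows of `C` have torsion exterior product, which is mapped to that of the `v k`.
  have h₅ : h ^ N₄ • ιMulti R d C = 0 := by
    rw [smul_ιMulti_eq_zero_iff_minors (Pi.basisFun R (Fin n))]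
    simpa using h₄
  have h₆ := congr(exteriorPower.map d (Fintype.linearCombination R E) $h₅)
  rw [map_smul, map_apply_ιMulti, map_zero] at h₆
  have h₇ : (fun k ↦ h ^ (N₁ + N₂ + N₃) • v k) =
      fun k ↦ h ^ N₃ • (⇑(Fintype.linearCombination R E) ∘ C) k := by
    ext k
    have := h₃ k
    rw [smul_sub, sub_eq_zero, smul_smul, ← pow_add] at this
    rw [add_comm, this]
    simp [Fintype.linearCombination_apply]
  refine ⟨N₄ + (N₁ + N₂ + N₃) * d, ?_⟩
  have h₈ := congr(h ^ N₄ • ιMulti R d $h₇)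
  rw [AlternatingMap.map_smul_univ, AlternatingMap.map_smul_univ, smul_comm (h ^ N₄) (∏ _, h ^ N₃),
    h₆, smul_zero] at h₈
  simpa [smul_smul, ← pow_add, ← pow_mul] using h₈

end ExteriorPower

/-! ### Localization of the module of points -/

section Localization

variable {S : Scheme.{u}} {A : Over S} [RingObj A] [GaAlgebra A] {n : ℕ}

lemma exists_frame_restrict (hA : IsVectorBundle A n) (T : Over S) (x : T.left) :
    ∃ V : T.left.Opens, x ∈ V ∧ IsAffineOpen V ∧
      ∃ e : Fin n → (restrict T V ⟶ A), IsFrameOver A (restrict T V) e := by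
  obtain ⟨U, hxU, e, he⟩ := hA (T.hom x)
  obtain ⟨V, hV, hxV, hVU⟩ := exists_isAffineOpen_mem_and_subset (U := T.hom ⁻¹ᵁ U) hxU
  let g : restrict T V ⟶ Over.mk U.ι :=
    Over.homMk (IsOpenImmersion.lift U.ι (V.ι ≫ T.hom) (by
      rw [Scheme.Opens.range_ι]
      rintro _ ⟨y, rfl⟩
      exact hVU y.2)) (IsOpenImmersion.lift_fac _ _ _)
  exact ⟨V, hxV, hV, _, IsFrameOver.comp (T := Over.mk U.ι) he g⟩

lemma exists_finite_frame_cover (hA : IsVectorBundle A n) (T : Over S) [IsAffine T.left] :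
    ∃ (ι : Type u) (_ : Finite ι) (V : ι → T.left.Opens), ⨆ i, V i = ⊤ ∧
      ∀ i, IsAffineOpen (V i) ∧
        ∃ e : Fin n → (restrict T (V i) ⟶ A), IsFrameOver A (restrict T (V i)) e := by
  choose V hxV hV e he using exists_frame_restrict hA T
  obtain ⟨t, ht⟩ := CompactSpace.elim_nhds_subcover (fun x ↦ (V x : Set T.left))
    fun x ↦ (V x).isOpen.mem_nhds (hxV x)
  refine ⟨t, inferInstance, fun x ↦ V x, ?_, fun x ↦ ⟨hV x, e x, he x⟩⟩
  refine TopologicalSpace.Opens.ext ?_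
  simpa [Set.iUnion_subtype] using ht

section Frame

variable {T : Over S} {h : Γ(T.left, ⊤)} {V W : T.left.Opens} {e : Fin n → (restrict T W ⟶ A)}

open Filter in
lemma IsFrameOver.exists_pow_smul_eq_zero (he : IsFrameOver A (restrict T W) e)
    (hW : IsAffineOpen W) (hV : V = W ⊓ T.left.basicOpen h) (le : V ≤ W)
    {m : restrict T W ⟶ A} (hm : restrictLE T le ≫ m = 0) :
    ∀ᶠ N : ℕ in atTop, (restrictι T W).left.appTop h ^ N • m = 0 := by
  have key : ∀ i, ∀ᶠ N : ℕ in atTop,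
      (restrictι T W).left.appTop h ^ N * he.basis.repr m i = 0 := fun i ↦ by
    obtain ⟨N, hN⟩ := exists_pow_mul_eq_zero hW hV le (r := he.basis.repr m i) (by
      rw [← he.basis_repr_comp, hm, map_zero]; rfl)
    filter_upwards [eventually_ge_atTop N] with K hK
    rw [← Nat.sub_add_cancel hK, pow_add, mul_assoc, hN, mul_zero]
  filter_upwards [eventually_all.2 key] with N hN
  apply he.basis.ext_elem
  intro i
  simpa using hN i

open Filter in
lemma IsFrameOver.exists_restrict_eq_pow_smul (he : IsFrameOver A (restrict T W) e)
    (hW : IsAffineOpen W) (hV : V = W ⊓ T.left.basicOpen h) (le : V ≤ W)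
    (m : restrict T V ⟶ A) :
    ∀ᶠ N : ℕ in atTop, ∃ m' : restrict T W ⟶ A,
      restrictLE T le ≫ m' = (restrictι T V).left.appTop h ^ N • m := by
  have key : ∀ i, ∀ᶠ N : ℕ in atTop, ∃ r, (restrictLE T le).left.appTop r =
      (restrictι T V).left.appTop h ^ N * (he.comp (restrictLE T le)).basis.repr m i := fun i ↦ by
    obtain ⟨N, r, hN⟩ := exists_restrict_eq_pow_mul hW hV le
      ((he.comp (restrictLE T le)).basis.repr m i)
    filter_upwards [eventually_ge_atTop N] with K hK
    refine ⟨(restrictι T W).left.appTop h ^ (K - N) * r, ?_⟩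
    rw [map_mul, map_pow, hN, restrictLE_appTop_restrictι, ← mul_assoc, ← pow_add,
      Nat.sub_add_cancel hK]
  filter_upwards [eventually_all.2 key] with N hN
  choose r hr using hN
  refine ⟨∑ i, r i • e i, ?_⟩
  conv_rhs => rw [← (he.comp (restrictLE T le)).basis.sum_repr m, Finset.smul_sum]
  rw [comp_sum]
  refine Finset.sum_congr rfl fun i _ ↦ ?_
  rw [comp_smul, hr, smul_smul, IsFrameOver.basis_apply]

end Frame

variable {T : Over S} [IsAffine T.left] (h : Γ(T.left, ⊤))

/-- The kernel of the restriction `A(T) → A(D(h))` is `h`-power torsion. -/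
lemma exists_pow_smul_eq_zero_of_restrict (hA : IsVectorBundle A n)
    {m : T ⟶ A} (hm : restrictι T (T.left.basicOpen h) ≫ m = 0) :
    ∃ N : ℕ, h ^ N • m = 0 := by
  obtain ⟨ι, _, V, hV, hV'⟩ := exists_finite_frame_cover hA T
  choose hVa e he using hV'
  obtain ⟨N, hN⟩ := (Filter.eventually_all.2 fun i ↦ (he i).exists_pow_smul_eq_zero (h := h)
    (hVa i) rfl inf_le_left (m := restrictι T (V i) ≫ m) (by
      rw [restrictLE_restrictι_assoc, ← restrictLE_restrictι T inf_le_right, Category.assoc, hm]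
      exact AddMonObj.comp_zero _)).exists
  refine ⟨N, hom_ext_of_cover V hV fun i ↦ ?_⟩
  rw [comp_smul, map_pow, hN i]
  exact (AddMonObj.comp_zero _).symm

/-- A section of `A` over `D(h)` extends to `T` after multiplication by a power of `h`. -/
lemma exists_restrict_eq_pow_smul_of_affine (hA : IsVectorBundle A n)
    (m : restrict T (T.left.basicOpen h) ⟶ A) :
    ∃ (N : ℕ) (m' : T ⟶ A), restrictι T (T.left.basicOpen h) ≫ m' =
      (restrictι T (T.left.basicOpen h)).left.appTop h ^ N • m := by
  obtain ⟨ι, _, V, hV, hV'⟩ := exists_finite_frame_cover hA T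
  choose hVa e he using hV'
  obtain ⟨N, hN⟩ := (Filter.eventually_all.2 fun i ↦ (he i).exists_restrict_eq_pow_smul (h := h)
    (hVa i) rfl inf_le_left (restrictLE T inf_le_right ≫ m)).exists
  choose y hy using hN
  -- The extensions `y i` over the `V i` agree on overlaps after multiplication by a further power.
  obtain ⟨K, hK⟩ := (Filter.eventually_all.2 fun i ↦ Filter.eventually_all.2 fun j ↦
    ((he i).comp (restrictLE T (inf_le_left : V i ⊓ V j ≤ _))).exists_pow_smul_eq_zero (h := h)
    ((hVa i).inf (hVa j)) rfl inf_le_left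
    (m := restrictLE T inf_le_left ≫ y i - restrictLE T inf_le_right ≫ y j) (by
      have h1 := congr(restrictLE T (le_inf (inf_le_left.trans inf_le_left) inf_le_right :
        V i ⊓ V j ⊓ T.left.basicOpen h ≤ _) ≫ $(hy i))
      have h2 := congr(restrictLE T (le_inf (inf_le_left.trans inf_le_right) inf_le_right :
        V i ⊓ V j ⊓ T.left.basicOpen h ≤ _) ≫ $(hy j))
      rw [comp_smul, map_pow, restrictLE_appTop_restrictι, restrictLE_restrictLE_assoc,
        restrictLE_restrictLE_assoc] at h1 h2
      rw [← pullbackPoint_apply, map_sub]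
      simp only [pullbackPoint_apply, restrictLE_restrictLE_assoc]
      rw [h1, h2, sub_self])).exists
  obtain ⟨x, hx⟩ := exists_glue V hV (fun i ↦ (restrictι T (V i)).left.appTop h ^ K • y i)
    fun i j ↦ by
      have := hK i j
      rw [smul_sub, sub_eq_zero] at this
      simpa only [comp_smul, map_pow, restrictLE_appTop_restrictι] using this
  refine ⟨K + N, x, ?_⟩
  refine hom_ext_of_cover (T := restrict T (T.left.basicOpen h))
    (fun i ↦ (T.left.basicOpen h).ι ⁻¹ᵁ V i) ?_ fun i ↦ ?_
  · rw [← Scheme.Hom.preimage_iSup, hV]; rfl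
  · obtain ⟨q, hq⟩ := exists_lift_restrict (restrictι (restrict T (T.left.basicOpen h))
      ((T.left.basicOpen h).ι ⁻¹ᵁ V i) ≫ restrictι T _) (V i ⊓ T.left.basicOpen h)
      fun x ↦ ⟨x.2, x.1.2⟩
    have hq' : q ≫ restrictLE T inf_le_right = restrictι (restrict T (T.left.basicOpen h))
      ((T.left.basicOpen h).ι ⁻¹ᵁ V i) := by
      rw [← cancel_mono (restrictι T (T.left.basicOpen h)), Category.assoc,
        restrictLE_restrictι, hq]
    rw [← hq', Category.assoc, Category.assoc, restrictLE_restrictι_assoc, comp_smul,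
      map_pow, restrictLE_appTop_restrictι, pow_add, mul_smul, ← hy i,
      ← restrictLE_restrictι_assoc T inf_le_left, hx, comp_smul, map_pow,
      restrictLE_appTop_restrictι]

end Localization

/-! ### Spectra of algebras over an affine base -/

section SpecOver

variable {S : Scheme.{u}}

variable {T : Over S} [IsAffine T.left] {Q : Type u} [CommRing Q] (φ : Γ(T.left, ⊤) →+* Q)

/-- The spectrum of a `Γ(T, ⊤)`-algebra `Q`, as an `S`-scheme over the affine `S`-scheme `T`. For
`Q = Γ(T, ⊤)[X]` it is, definitionally, `line T`. -/
noncomputable abbrev specOver : Over S :=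
  Over.mk (Spec.map (CommRingCat.ofHom φ) ≫ T.left.isoSpec.inv ≫ T.hom)

instance : IsAffine (specOver φ).left := inferInstanceAs (IsAffine (Spec _))

/-- The structure morphism from the spectrum of a `Γ(T, ⊤)`-algebra to `T`. -/
noncomputable def specProj : specOver φ ⟶ T :=
  Over.homMk (Spec.map (CommRingCat.ofHom φ) ≫ T.left.isoSpec.inv) (by simp)

/-- The ring of functions of the spectrum of `Q` is `Q`. -/
noncomputable def specFunctions : Γ((specOver φ).left, ⊤) ≃+* Q :=
  (Scheme.ΓSpecIso (CommRingCat.of Q)).commRingCatIsoToRingEquiv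

lemma specProj_appTop (r : Γ(T.left, ⊤)) :
    (specProj φ).left.appTop r = (specFunctions φ).symm (φ r) := by
  have h1 : T.left.isoSpec.inv.appTop = (Scheme.ΓSpecIso Γ(T.left, ⊤)).inv := by
    rw [← cancel_mono (Scheme.ΓSpecIso Γ(T.left, ⊤)).hom, Iso.inv_hom_id, ← Scheme.toSpecΓ_appTop,
      ← Scheme.Hom.comp_appTop, Scheme.toSpecΓ_isoSpec_inv, Scheme.Hom.id_appTop]
  have h2 := Scheme.ΓSpecIso_inv_naturality (CommRingCat.ofHom φ)
  have h3 : (specProj φ).left.appTop =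
      CommRingCat.ofHom φ ≫ (Scheme.ΓSpecIso (CommRingCat.of Q)).inv := by
    rw [h2]
    exact (Scheme.Hom.comp_appTop _ _).trans congr($h1 ≫ _)
  rw [h3]
  rfl

/-- The universal property of the spectrum of a `Γ(T, ⊤)`-algebra. -/
lemma exists_lift_specOver {T' : Over S} (g : T' ⟶ T) (ψ : Q →+* Γ(T'.left, ⊤))
    (h : ∀ r, ψ (φ r) = g.left.appTop r) :
    ∃ q : T' ⟶ specOver φ, q ≫ specProj φ = g ∧
      ∀ y, q.left.appTop y = ψ (specFunctions φ y) := by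
  have key : (T'.left.toSpecΓ ≫ Spec.map (CommRingCat.ofHom ψ)) ≫
      Spec.map (CommRingCat.ofHom φ) ≫ T.left.isoSpec.inv = g.left := by
    have : CommRingCat.ofHom φ ≫ CommRingCat.ofHom ψ = g.left.appTop := by
      ext r; exact h r
    rw [Category.assoc, ← Spec.map_comp_assoc, this, ← Scheme.toSpecΓ_naturality_assoc,
      Scheme.toSpecΓ_isoSpec_inv, Category.comp_id]
  refine ⟨Over.homMk (T'.left.toSpecΓ ≫ Spec.map (CommRingCat.ofHom ψ)) ?_, ?_, fun y ↦ ?_⟩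
  · rw [← Over.w g, ← key]
    simp
  · ext1; exact key
  · have h2 : (T'.left.toSpecΓ ≫ Spec.map (CommRingCat.ofHom ψ)).appTop =
        (Scheme.ΓSpecIso (CommRingCat.of Q)).hom ≫ CommRingCat.ofHom ψ := by
      rw [Scheme.Hom.comp_appTop, Scheme.toSpecΓ_appTop]
      exact Scheme.ΓSpecIso_naturality (CommRingCat.ofHom ψ)
    exact congr($h2 y)

end SpecOver

/-! ### Exterior products of powers and the generic point -/

section GenericPoint

variable {S : Scheme.{u}} {A : Over S} [RingObj A] [GaAlgebra A] {n d : ℕ}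

/-- Pullback of points along `g`, as a semilinear map `A(T) → A(T')`. -/
noncomputable def pullbackSemilinear {T T' : Over S} (g : T' ⟶ T) :
    (T ⟶ A) →ₛₗ[g.left.appTop.hom] (T' ⟶ A) where
  toFun a := g ≫ a
  map_add' := map_add (pullbackPoint g)
  map_smul' := comp_smul g

/-- The element `1 ∧ a ∧ ⋯ ∧ a ^ (d - 1)` of the `d`-th exterior power of `A(T)`. -/
noncomputable def powersWedge (d : ℕ) {T : Over S} (a : T ⟶ A) : ⋀[Γ(T.left, ⊤)]^d (T ⟶ A) :=
  exteriorPower.ιMulti Γ(T.left, ⊤) d (fun i : Fin d ↦ a ^ (i : ℕ))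

lemma powersWedge_comp {T T' : Over S} (g : T' ⟶ T) (a : T ⟶ A) :
    powersWedge d (g ≫ a) = exteriorPower.ιMulti Γ(T'.left, ⊤) d
      (fun i : Fin d ↦ pullbackSemilinear g (a ^ (i : ℕ))) := by
  have (i : Fin d) : (g ≫ a) ^ (i : ℕ) = pullbackSemilinear g (a ^ (i : ℕ)) :=
    (map_pow (pullbackPoint g) a i).symm
  simp only [powersWedge, this]

lemma powersWedge_comp_eq_zero {T T' : Over S} (g : T' ⟶ T) {a : T ⟶ A}
    (ha : powersWedge d a = 0) : powersWedge d (g ≫ a) = 0 := by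
  rw [powersWedge_comp]
  exact ιMulti_semilinear_eq_zero _ ha

lemma powersWedge_eq_zero_of_injective {T T' : Over S} {e : Fin n → (T ⟶ A)}
    (he : IsFrameOver A T e) (g : T' ⟶ T) (hg : Function.Injective g.left.appTop) {a : T ⟶ A}
    (ha : powersWedge d (g ≫ a) = 0) : powersWedge d a = 0 := by
  rw [powersWedge_comp] at ha
  have hb : ∀ m i, (he.comp g).basis.repr (pullbackSemilinear g m) i =
      g.left.appTop.hom (he.basis.repr m i) := he.basis_repr_comp g
  exact ιMulti_eq_zero_of_semilinear _ hg he.basis (he.comp g).basis hb ha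

/-- Vanishing of `1 ∧ a ∧ ⋯ ∧ a ^ (d - 1)` can be checked locally on an affine `T`. -/
lemma powersWedge_eq_zero_of_local (hA : IsVectorBundle A n) {T : Over S} [IsAffine T.left]
    (a : T ⟶ A)
    (H : ∀ x : T.left, ∃ V : T.left.Opens, x ∈ V ∧ powersWedge d (restrictι T V ≫ a) = 0) :
    powersWedge d a = 0 := by
  have key : ∀ x : T.left, ∃ h : Γ(T.left, ⊤), x ∈ T.left.basicOpen h ∧
      ∃ N : ℕ, h ^ N • powersWedge d a = 0 := by
    intro x
    obtain ⟨V, hxV, hV⟩ := H x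
    obtain ⟨W, hxW, -, e, he⟩ := exists_frame_restrict hA T x
    obtain ⟨h, hle, hx⟩ := (isAffineOpen_top T.left).exists_basicOpen_le
      (V := V ⊓ W) ⟨x, hxV, hxW⟩ trivial
    refine ⟨h, hx, ?_⟩
    have hD := powersWedge_comp_eq_zero (restrictLE T (hle.trans inf_le_left)) hV
    rw [restrictLE_restrictι_assoc, powersWedge_comp] at hD
    have : IsIso (⊤ : T.left.Opens).ι := inferInstanceAs (IsIso T.left.topIso.hom)
    have : IsIso (⊤ : T.left.Opens).ι.appTop :=
      inferInstanceAs (IsIso ((⊤ : T.left.Opens).ι.app ⊤))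
    obtain ⟨inj, surj⟩ : Function.Bijective (restrictι T ⊤).left.appTop :=
      ConcreteCategory.bijective_of_isIso (⊤ : T.left.Opens).ι.appTop
    refine exists_pow_smul_ιMulti_eq_zero _ h (fun r hr ↦ ?_) (fun s ↦ ?_)
      (fun m hm ↦ exists_pow_smul_eq_zero_of_restrict h hA hm)
      (exists_restrict_eq_pow_smul_of_affine h hA)
      (he.comp (restrictLE T (hle.trans inf_le_right))).basis hD
    · obtain ⟨N, hN⟩ := exists_pow_mul_eq_zero (V := T.left.basicOpen h) (h := h)
        (isAffineOpen_top T.left) (by simp) le_top (r := (restrictι T ⊤).left.appTop r)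
        ((restrictLE_appTop_restrictι _ _).trans hr)
      exact ⟨N, inj (by rw [map_mul, map_pow, hN, map_zero])⟩
    · obtain ⟨N, r, hN⟩ := exists_restrict_eq_pow_mul (V := T.left.basicOpen h) (h := h)
        (isAffineOpen_top T.left) (by simp) le_top s
      obtain ⟨r, rfl⟩ := surj r
      exact ⟨N, r, (restrictLE_appTop_restrictι _ _).symm.trans hN⟩
  choose h hx hN using key
  let I := LinearMap.ker (LinearMap.toSpanSingleton Γ(T.left, ⊤) _ (powersWedge d a))
  have h1 : Ideal.span (Set.range h) = ⊤ := by
    rw [← (isAffineOpen_top T.left).iSup_basicOpen_eq_self_iff]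
    refine top_le_iff.1 fun x _ ↦ ?_
    exact TopologicalSpace.Opens.mem_iSup.2 ⟨⟨h x, x, rfl⟩, hx x⟩
  have h2 : Ideal.span (Set.range h) ≤ Ideal.radical I := by
    rw [Ideal.span_le]
    rintro _ ⟨x, rfl⟩
    exact hN x
  have h3 : (1 : Γ(T.left, ⊤)) ∈ I := by
    rw [← Ideal.eq_top_iff_one, ← Ideal.radical_eq_top, ← top_le_iff, ← h1]
    exact h2
  simpa [I] using h3

section Generic

variable {T : Over S} [IsAffine T.left]

/-- Affine `n`-space over the affine `S`-scheme `T`. -/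
noncomputable abbrev affineSpaceOver (T : Over S) [IsAffine T.left] (n : ℕ) : Over S :=
  specOver (T := T) (MvPolynomial.C (σ := Fin n) (R := Γ(T.left, ⊤)))

/-- The projection of affine `n`-space over `T` to `T`. -/
noncomputable abbrev affineSpaceProj (T : Over S) [IsAffine T.left] (n : ℕ) :
    affineSpaceOver T n ⟶ T := specProj _

/-- The functions on affine `n`-space over `T` are the polynomials in `n` variables over `Γ(T, ⊤)`.
-/
noncomputable abbrev affineSpaceFunctions (T : Over S) [IsAffine T.left] (n : ℕ) :
    Γ((affineSpaceOver T n).left, ⊤) ≃+* MvPolynomial (Fin n) Γ(T.left, ⊤) := specFunctions _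

/-- The point `x₁ e₁ + ⋯ + xₙ eₙ` of `A` with values in affine `n`-space over `T`. When the `eᵢ`
form a frame, every point of `A` over a `T`-scheme is a pullback of it
(`exists_comp_genericPoint_eq`). -/
noncomputable def genericPoint (e : Fin n → (T ⟶ A)) : affineSpaceOver T n ⟶ A :=
  ∑ i, (affineSpaceFunctions T n).symm (.X i) • (affineSpaceProj T n ≫ e i)

lemma exists_comp_genericPoint_eq {e : Fin n → (T ⟶ A)} (he : IsFrameOver A T e)
    {T' : Over S} (g : T' ⟶ T) (a : T' ⟶ A) :
    ∃ q : T' ⟶ affineSpaceOver T n, q ≫ genericPoint e = a := by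
  obtain ⟨q, hq, hq'⟩ := exists_lift_specOver (T := T) MvPolynomial.C g
    (MvPolynomial.eval₂Hom g.left.appTop.hom ((he.comp g).basis.repr a)) (by simp)
  refine ⟨q, ?_⟩
  rw [genericPoint, comp_sum]
  conv_rhs => rw [← (he.comp g).basis.sum_repr a]
  refine Finset.sum_congr rfl fun i _ ↦ ?_
  rw [comp_smul, hq', ← Category.assoc, hq]
  simp

lemma powersWedge_eq_zero_of_genericPoint {e : Fin n → (T ⟶ A)} (he : IsFrameOver A T e)
    (h : powersWedge d (genericPoint e) = 0) {T' : Over S} (g : T' ⟶ T) (a : T' ⟶ A) :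
    powersWedge d a = 0 := by
  obtain ⟨q, rfl⟩ := exists_comp_genericPoint_eq he g a
  exact powersWedge_comp_eq_zero q h

lemma powersWedge_genericPoint_eq_zero_of_injective {e : Fin n → (T ⟶ A)} (he : IsFrameOver A T e)
    {T' : Over S} [IsAffine T'.left] (g : T' ⟶ T) (hg : Function.Injective g.left.appTop)
    (H : ∀ (T'' : Over S) (_ : T'' ⟶ T') (a : T'' ⟶ A), powersWedge d a = 0) :
    powersWedge d (genericPoint e) = 0 := by
  obtain ⟨q, -, hq⟩ := exists_lift_specOver (T := T) MvPolynomial.C (affineSpaceProj T' n ≫ g)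
    ((affineSpaceFunctions T' n).symm.toRingHom.comp (MvPolynomial.map g.left.appTop.hom)) (by
      intro r
      rw [Over.comp_left, Scheme.Hom.comp_appTop, CommRingCat.comp_apply, specProj_appTop]
      simp)
  refine powersWedge_eq_zero_of_injective (he.comp (affineSpaceProj T n)) q ?_
    (H _ (affineSpaceProj T' n) _)
  have : ⇑q.left.appTop = (affineSpaceFunctions T' n).symm ∘ MvPolynomial.map g.left.appTop.hom ∘
      affineSpaceFunctions T n := funext hq
  rw [this]
  exact (affineSpaceFunctions T' n).symm.injective.comp
    ((MvPolynomial.map_injective _ hg).comp (affineSpaceFunctions T n).injective)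

end Generic

lemma exists_frame_isAffineOpen (hA : IsVectorBundle A n) (x : S) :
    ∃ U : S.Opens, x ∈ U ∧ IsAffineOpen U ∧ ∃ e : Fin n → (Over.mk U.ι ⟶ A), IsFrame A U e := by
  obtain ⟨U, hxU, e, he⟩ := hA x
  obtain ⟨V, hV, hxV, hVU⟩ := exists_isAffineOpen_mem_and_subset (U := U) hxU
  let g : Over.mk V.ι ⟶ Over.mk U.ι := Over.homMk (S.homOfLE hVU) (S.homOfLE_ι hVU)
  exact ⟨V, hxV, hV, _, IsFrameOver.comp (T := Over.mk U.ι) he g⟩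

/-- If `1 ∧ a ∧ ⋯ ∧ a ^ k` is not identically zero on `A`, it is nonzero at the generic point of
`A` over every nonempty affine open. Otherwise, as `S` is irreducible, it would vanish at every
point over some nonempty open part of any other chart, hence, functions on an integral scheme being
determined on nonempty opens, at the generic point over that chart, and then at every point of `A`.
-/
lemma powersWedge_genericPoint_ne_zero [IsIntegral S] (hA : IsVectorBundle A n)
    {k : ℕ} (hk : ¬ DegreeLE A k) {U : S.Opens} [Nonempty U]
    [IsAffine (Over.mk U.ι).left]
    {e : Fin n → (Over.mk U.ι ⟶ A)} (he : IsFrame A U e) :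
    powersWedge (k + 1) (genericPoint e) ≠ 0 := by
  intro h0
  refine hk fun T _ a ↦ powersWedge_eq_zero_of_local hA a fun x ↦ ?_
  obtain ⟨V, hxV, hV, e', he'⟩ := exists_frame_isAffineOpen hA (T.hom x)
  refine ⟨T.hom ⁻¹ᵁ V, hxV, ?_⟩
  have : IsAffine (Over.mk V.ι).left := hV
  obtain ⟨gT⟩ := exists_restrict_preimage T V
  refine powersWedge_eq_zero_of_genericPoint (T := Over.mk V.ι) he' ?_ gT _
  obtain ⟨y, hyU, hyV⟩ : ((U ⊓ V : S.Opens) : Set S).Nonempty :=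
    nonempty_preirreducible_inter U.isOpen V.isOpen
      (by obtain ⟨y⟩ := ‹Nonempty U›; exact ⟨y.1, y.2⟩) ⟨_, hxV⟩
  obtain ⟨W, hW, hyW, hWle⟩ := exists_isAffineOpen_mem_and_subset (U := U ⊓ V) ⟨hyU, hyV⟩
  have : IsAffine (Over.mk W.ι).left := hW
  have : Nonempty W := ⟨⟨y, hyW⟩⟩
  have hWU : W ≤ U := fun z hz ↦ (hWle hz).1
  have hWV : W ≤ V := fun z hz ↦ (hWle hz).2
  refine powersWedge_genericPoint_eq_zero_of_injective (T := Over.mk V.ι) (T' := Over.mk W.ι)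
    he' (Over.homMk (S.homOfLE hWV)) ?_ fun T'' g b ↦
    powersWedge_eq_zero_of_genericPoint (T := Over.mk U.ι) he h0
      (g ≫ (Over.homMk (S.homOfLE hWU))) b
  change Function.Injective (S.homOfLE hWV).appTop
  rw [Scheme.homOfLE_appTop]
  exact map_injective_of_isIntegral (H := ⟨⟨y, ⟨⟨y, hyW⟩, trivial, rfl⟩⟩⟩) S _

end GenericPoint

/-! ### Monic polynomials from homogeneous ones -/

section Homogeneous

variable {R Q : Type*} [CommRing R] [CommRing Q] {ι : Type*}

/-- A product of the linear polynomials `uᵢ X - yᵢ` has the expected degree bound and top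
coefficient. -/
lemma natDegree_prod_pow_le (s : Finset ι) (m : ι → ℕ) (u y : ι → Q) :
    (∏ i ∈ s, (Polynomial.X * Polynomial.C (u i) - Polynomial.C (y i)) ^ m i).natDegree ≤
        ∑ i ∈ s, m i ∧
      (∏ i ∈ s, (Polynomial.X * Polynomial.C (u i) - Polynomial.C (y i)) ^ m i).coeff
        (∑ i ∈ s, m i) = ∏ i ∈ s, u i ^ m i := by
  classical
  induction s using Finset.induction_on with
  | empty => simp
  | insert i s hi ih =>
    rw [Finset.prod_insert hi, Finset.sum_insert hi, Finset.prod_insert hi]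
    have h1 : (Polynomial.X * Polynomial.C (u i) - Polynomial.C (y i)).natDegree ≤ 1 := by
      compute_degree
    have h2 : ((Polynomial.X * Polynomial.C (u i) - Polynomial.C (y i)) ^ m i).natDegree ≤ m i := by
      simpa using Polynomial.natDegree_pow_le_of_le (m i) h1
    refine ⟨Polynomial.natDegree_mul_le_of_le h2 ih.1, ?_⟩
    rw [Polynomial.coeff_mul_add_eq_of_natDegree_le h2 ih.1, ih.2]
    congr 1
    have := Polynomial.coeff_pow_of_natDegree_le (m := m i) h1
    rw [mul_one] at this
    rw [this]
    simp [Polynomial.coeff_C]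

/-- If `P` is homogeneous of degree `d`, then `P(X u - y)` has degree at most `d` in `X`, and the
coefficient of `X ^ d` is `P(u)`. -/
lemma natDegree_eval₂_le_and_coeff [Fintype ι] {P : MvPolynomial ι R} {d : ℕ}
    (hP : P.IsHomogeneous d) (ρ : R →+* Q) (u y : ι → Q) :
    (P.eval₂ (Polynomial.C.comp ρ)
        fun i ↦ Polynomial.X * Polynomial.C (u i) - Polynomial.C (y i)).natDegree ≤ d ∧
      (P.eval₂ (Polynomial.C.comp ρ)
        fun i ↦ Polynomial.X * Polynomial.C (u i) - Polynomial.C (y i)).coeff d =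
      P.eval₂ ρ u := by
  rw [MvPolynomial.eval₂_eq', MvPolynomial.eval₂_eq']
  have hm : ∀ m ∈ P.support, ∑ i, m i = d := fun m hm ↦ by
    have := hP (MvPolynomial.mem_support_iff.1 hm)
    rwa [← Finsupp.degree_eq_sum, Finsupp.degree_eq_weight_one]
  constructor
  · refine Polynomial.natDegree_sum_le_of_forall_le _ _ fun m hmP ↦ ?_
    rw [← hm m hmP]
    exact (Polynomial.natDegree_C_mul_le _ _).trans (natDegree_prod_pow_le _ _ _ _).1
  · rw [Polynomial.finsetSum_coeff]
    refine Finset.sum_congr rfl fun m hmP ↦ ?_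
    rw [← hm m hmP, RingHom.comp_apply, Polynomial.coeff_C_mul, (natDegree_prod_pow_le _ _ _ _).2]

/-- If `1, b, …, b ^ (d - 1)` are linearly independent, then `b` is a root of at most one monic
polynomial of degree `d`. -/
lemma eq_of_monic_of_linearIndependent {B : Type*} [Ring B] [Algebra Q B] {d : ℕ} {b : B}
    (hb : LinearIndependent Q fun i : Fin d ↦ b ^ (i : ℕ)) {p q : Q[X]}
    (hp : p.natDegree ≤ d) (hp' : p.coeff d = 1) (hq : q.natDegree ≤ d) (hq' : q.coeff d = 1)
    (hpb : Polynomial.aeval b p = 0) (hqb : Polynomial.aeval b q = 0) : p = q := by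
  have h1 : Polynomial.aeval b (p - q) = 0 := by rw [map_sub, hpb, hqb, sub_zero]
  have h2 : ∀ i, d ≤ i → (p - q).coeff i = 0 := fun i hi ↦ by
    rcases hi.eq_or_lt with rfl | hi
    · rw [Polynomial.coeff_sub, hp', hq', sub_self]
    · rw [Polynomial.coeff_sub, Polynomial.coeff_eq_zero_of_natDegree_lt (hp.trans_lt hi),
        Polynomial.coeff_eq_zero_of_natDegree_lt (hq.trans_lt hi), sub_self]
  have h3 : (p - q).natDegree < d + 1 := by
    refine (Polynomial.natDegree_sub_le _ _).trans_lt ?_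
    simp only [Nat.lt_succ_iff]
    exact max_le hp hq
  rw [Polynomial.aeval_eq_sum_range' h3, Finset.sum_range_succ, h2 d le_rfl, zero_smul, add_zero,
    Finset.sum_range] at h1
  have h4 := Fintype.linearIndependent_iff.1 hb _ h1
  rw [← sub_eq_zero]
  ext i
  by_cases hi : i < d
  · exact h4 ⟨i, hi⟩
  · exact h2 i (not_lt.1 hi)

end Homogeneous

/-! ### Uniqueness of the determinant -/

section Uniqueness

variable {S : Scheme.{u}} {A : Over S} [RingObj A] [GaAlgebra A] {n d : ℕ}

lemma lineFunctions_lineProj (T : Over S) [IsAffine T.left] (r : Γ(T.left, ⊤)) :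
    lineFunctions T ((lineProj T).left.appTop r) = Polynomial.C r := by
  have := specProj_appTop (T := T) (Polynomial.C (R := Γ(T.left, ⊤))) r
  exact congr(lineFunctions T $this).trans ((lineFunctions T).apply_symm_apply _)

section CharPoly

variable {T₀ : Over S} {e : Fin n → (T₀ ⟶ A)} {δ : Γ(A.left, ⊤)}
  {P : MvPolynomial (Fin n) Γ(T₀.left, ⊤)}

/-- If `δ` is given by the polynomial `P` in terms of a frame, then `δ(X - a)` is `P(X u - c)`,
where `u` and `c` are the coordinates of `1` and `a`. -/
lemma charPoly_sum_smul (he : IsFrameOver A T₀ e)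
    (hP : ∀ (T : Over S) (g : T ⟶ T₀) (c : Fin n → Γ(T.left, ⊤)),
      value δ (∑ i, c i • (g ≫ e i)) = P.eval₂ g.left.appTop.hom c)
    {T : Over S} [IsAffine T.left] (g : T ⟶ T₀) (c : Fin n → Γ(T.left, ⊤)) :
    charPoly δ (∑ i, c i • (g ≫ e i)) = P.eval₂ (Polynomial.C.comp g.left.appTop.hom) fun i ↦
      Polynomial.X * Polynomial.C (g.left.appTop (he.basis.repr 1 i)) - Polynomial.C (c i) := by
  have h1 : (1 : T ⟶ A) = ∑ i, g.left.appTop (he.basis.repr 1 i) • (g ≫ e i) := by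
    have : (1 : T ⟶ A) = g ≫ 1 := (MonObj.comp_one g).symm
    rw [this]
    conv_lhs => rw [← he.basis.sum_repr 1, comp_sum]
    simp [comp_smul]
  have h2 : (algebraMap _ (line T ⟶ A) ((lineFunctions T).symm Polynomial.X) -
      lineProj T ≫ ∑ i, c i • (g ≫ e i)) =
      ∑ i, ((lineFunctions T).symm Polynomial.X *
        (lineProj T).left.appTop (g.left.appTop (he.basis.repr 1 i)) -
          (lineProj T).left.appTop (c i)) • ((lineProj T ≫ g) ≫ e i) := by
    have : (1 : line T ⟶ A) = lineProj T ≫ 1 := (MonObj.comp_one _).symm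
    rw [Algebra.algebraMap_eq_smul_one, this, h1, comp_sum, comp_sum, Finset.smul_sum,
      ← Finset.sum_sub_distrib]
    refine Finset.sum_congr rfl fun i _ ↦ ?_
    rw [comp_smul, comp_smul, sub_smul, mul_smul, Category.assoc]
  rw [charPoly, h2, hP, ← RingEquiv.coe_toRingHom, MvPolynomial.hom_eval₂]
  congr 1
  · refine RingHom.ext fun r ↦ ?_
    rw [Over.comp_left, Scheme.Hom.comp_appTop]
    exact lineFunctions_lineProj T _
  · ext1 i
    rw [RingEquiv.coe_toRingHom, map_sub, map_mul,
      RingEquiv.apply_symm_apply, lineFunctions_lineProj, lineFunctions_lineProj]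

variable [IsAffine T₀.left]

/-- At the generic point, the polynomial `δ(X - a)` is monic of degree `d`, and its value at `0` is
`δ(-a)`. -/
lemma charPoly_genericPoint (he : IsFrameOver A T₀ e) (hP : P.IsHomogeneous d)
    (hPe : ∀ (T : Over S) (g : T ⟶ T₀) (c : Fin n → Γ(T.left, ⊤)),
      value δ (∑ i, c i • (g ≫ e i)) = P.eval₂ g.left.appTop.hom c)
    (hδ : value δ (1 : T₀ ⟶ A) = 1) :
    (charPoly δ (genericPoint e)).natDegree ≤ d ∧ (charPoly δ (genericPoint e)).coeff d = 1 ∧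
      (charPoly δ (genericPoint e)).eval 0 = value δ (- genericPoint e) := by
  have h2 := natDegree_eval₂_le_and_coeff hP (affineSpaceProj T₀ n).left.appTop.hom
    (fun i ↦ (affineSpaceProj T₀ n).left.appTop.hom (he.basis.repr 1 i))
    (fun i ↦ (affineSpaceFunctions T₀ n).symm (.X i))
  have h1 := charPoly_sum_smul he hPe (affineSpaceProj T₀ n)
    (fun i ↦ (affineSpaceFunctions T₀ n).symm (.X i))
  rw [genericPoint, h1]
  refine ⟨h2.1, h2.2.trans ?_, ?_⟩
  · have h3 := hPe T₀ (𝟙 _) (he.basis.repr 1)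
    have h4 : ∑ i, he.basis.repr 1 i • (𝟙 T₀ ≫ e i) = 1 := by
      conv_rhs => rw [← he.basis.sum_repr 1]
      simp
    rw [h4, hδ] at h3
    have h5 := congr((affineSpaceProj T₀ n).left.appTop.hom $h3)
    rw [map_one, MvPolynomial.hom_eval₂] at h5
    simpa using h5.symm
  · rw [← Finset.sum_neg_distrib]
    simp only [← neg_smul]
    rw [hPe, ← Polynomial.coe_evalRingHom, MvPolynomial.hom_eval₂]
    congr 1
    · refine RingHom.ext fun r ↦ ?_
      simp
    · ext1 i
      simp

end CharPoly

/-- Uniqueness of the determinant, over an affine chart. If `δ` and `δ'` are two determinants and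
`a` is the generic point, then `δ(X - a)` and `δ'(X - a)` are monic polynomials of degree `k + 1`
killing `a`, whose powers `1, …, a ^ k` are linearly independent. So they are equal, and at `X = 0`
this gives `δ(-a) = δ'(-a)`. -/
lemma IsDeterminant.value_eq_value [IsIntegral S] (hA : IsVectorBundle A n) {k : ℕ}
    (hk : ¬ DegreeLE A k) {δ δ' : Γ(A.left, ⊤)} (hδ : IsDeterminant n (k + 1) δ)
    (hδ' : IsDeterminant n (k + 1) δ') {U : S.Opens} [Nonempty U] (hU : IsAffineOpen U)
    {e : Fin n → (Over.mk U.ι ⟶ A)} (he : IsFrame A U e) {T : Over S} (g : T ⟶ Over.mk U.ι)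
    (a : T ⟶ A) : value δ a = value δ' a := by
  have : IsAffine (Over.mk U.ι).left := hU
  have ne := powersWedge_genericPoint_ne_zero hA hk he
  obtain ⟨P, hP, hPe⟩ := hδ.isSymSection U e he
  obtain ⟨P', hP', hPe'⟩ := hδ'.isSymSection U e he
  have : IsDomain Γ((Over.mk U.ι).left, ⊤) :=
    inferInstanceAs (IsDomain Γ(U.toScheme, ⊤))
  replace he : IsFrameOver A (Over.mk U.ι) e := he
  generalize Over.mk U.ι = T₀ at *
  have : IsDomain Γ((affineSpaceOver T₀ n).left, ⊤) :=
    (affineSpaceFunctions T₀ n).toMulEquiv.isDomain _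
  have ind : LinearIndependent _ fun i : Fin (k + 1) ↦ genericPoint e ^ (i : ℕ) :=
    linearIndependent_of_ιMulti_ne_zero (he.comp (affineSpaceProj T₀ n)).basis ne
  obtain ⟨h1, h2, h3⟩ := charPoly_genericPoint he hP hPe (hδ.value_one T₀)
  obtain ⟨h1', h2', h3'⟩ := charPoly_genericPoint he hP' hPe' (hδ'.value_one T₀)
  have h4 := eq_of_monic_of_linearIndependent ind h1 h2 h1' h2'
    (hδ.aeval_charPoly _ _) (hδ'.aeval_charPoly _ _)
  rw [h4, h3'] at h3
  obtain ⟨q, hq⟩ := exists_comp_genericPoint_eq he g (-a)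
  have h5 : a = q ≫ (- genericPoint e) := by
    rw [← pullbackPoint_apply, map_neg, pullbackPoint_apply, hq, neg_neg]
  rw [h5, value_comp, value_comp, h3]

end Uniqueness

/-! ### Automorphisms and antiautomorphisms -/

section Automorphisms

variable {S : Scheme.{u}} {A : Over S} [RingObj A]

/-- The morphism `f` is an isomorphism inducing on `T`-points, for all `T`, a ring homomorphism,
or, for all `T`, an antihomomorphism of rings. -/
structure IsAutOrAntiaut (f : A ⟶ A) : Prop where
  isIso : IsIso f
  add_comp (T : Over S) (a b : T ⟶ A) : (a + b) ≫ f = a ≫ f + b ≫ f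
  one_comp (T : Over S) : (1 : T ⟶ A) ≫ f = 1
  mul_comp : (∀ (T : Over S) (a b : T ⟶ A), (a * b) ≫ f = (a ≫ f) * (b ≫ f)) ∨
    ∀ (T : Over S) (a b : T ⟶ A), (a * b) ≫ f = (b ≫ f) * (a ≫ f)

lemma IsRingAut.isAutOrAntiaut {f : A ⟶ A} (hf : IsRingAut f) : IsAutOrAntiaut f :=
  have := hf.isRingHom
  ⟨hf.isIso, fun _ _ _ ↦ AddMonObj.add_comp _ _ _, fun _ ↦ MonObj.one_comp _,
    .inl fun _ _ _ ↦ MonObj.mul_comp _ _ _⟩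

lemma IsRingAntiaut.isAutOrAntiaut {f : A ⟶ A} (hf : IsRingAntiaut f) : IsAutOrAntiaut f :=
  have := hf.isAddMonHom
  ⟨hf.isIso, fun _ _ _ ↦ AddMonObj.add_comp _ _ _, hf.one_comp, .inr hf.mul_comp⟩

namespace IsAutOrAntiaut

variable {f : A ⟶ A}

/-- The additive endomorphism of `A(T)` induced by `f`. -/
noncomputable def postcomp (hf : IsAutOrAntiaut f) (T : Over S) : (T ⟶ A) →+ (T ⟶ A) :=
  AddMonoidHom.mk' (· ≫ f) (hf.add_comp T)

lemma pow_comp (hf : IsAutOrAntiaut f) {T : Over S} (a : T ⟶ A) (k : ℕ) :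
    (a ^ k) ≫ f = (a ≫ f) ^ k := by
  induction k with
  | zero => simpa using hf.one_comp T
  | succ k ih =>
    rcases hf.mul_comp with h | h
    · rw [pow_succ, h, ih, pow_succ]
    · rw [pow_succ, h, ih, pow_succ']

end IsAutOrAntiaut

variable [GaAlgebra A] {n d : ℕ}

namespace IsAutOrAntiaut

variable {f : A ⟶ A}

lemma algebraMap_comp (hf : IsAutOrAntiaut f) (hlin : IsGaLinear f) {T : Over S}
    (r : Γ(T.left, ⊤)) :
    algebraMap _ (T ⟶ A) r ≫ f = algebraMap _ (T ⟶ A) r := by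
  rw [Algebra.algebraMap_eq_smul_one, hlin, hf.one_comp]

lemma aeval_comp (hf : IsAutOrAntiaut f) (hlin : IsGaLinear f)
    {T : Over S} (a : T ⟶ A) (p : Γ(T.left, ⊤)[X]) :
    Polynomial.aeval a p ≫ f = Polynomial.aeval (a ≫ f) p := by
  rw [Polynomial.aeval_eq_sum_range, Polynomial.aeval_eq_sum_range]
  refine (map_sum (hf.postcomp T) _ _).trans (Finset.sum_congr rfl fun i _ ↦ ?_)
  exact (hlin _ _ _).trans (by rw [hf.pow_comp])

lemma charPoly_appTop (hf : IsAutOrAntiaut f) (hlin : IsGaLinear f)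
    (δ : Γ(A.left, ⊤)) {T : Over S} [IsAffine T.left]
    (a : T ⟶ A) :
    charPoly (f.left.appTop δ) a = charPoly δ (a ≫ f) := by
  rw [charPoly, charPoly, value_appTop]
  have := map_sub (hf.postcomp (line T))
    (algebraMap _ (line T ⟶ A) ((lineFunctions T).symm Polynomial.X)) (lineProj T ≫ a)
  change (_ - _) ≫ f = _ ≫ f - (_ ≫ _) ≫ f at this
  rw [this, hf.algebraMap_comp hlin, Category.assoc]

/-- The composite of a determinant with a `𝔾ₐ`-linear ring automorphism or antiautomorphism is a
determinant. -/
lemma isDeterminant_appTop (hf : IsAutOrAntiaut f) (hlin : IsGaLinear f)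
    {δ : Γ(A.left, ⊤)} (hδ : IsDeterminant n d δ) :
    IsDeterminant n d (f.left.appTop δ) := by
  have := hf.isIso
  have hsum {T U : Over S} (g : T ⟶ U) (e : Fin n → (U ⟶ A)) (c : Fin n → Γ(T.left, ⊤)) :
      (∑ i, c i • (g ≫ e i)) ≫ f = ∑ i, c i • (g ≫ (e i ≫ f)) := by
    refine (map_sum (hf.postcomp T) _ _).trans (Finset.sum_congr rfl fun i _ ↦ ?_)
    exact (hlin _ _ _).trans (by rw [Category.assoc])
  refine ⟨fun U e he ↦ ?_, fun T ↦ ?_, fun T a b ↦ ?_, fun T _ a ↦ ?_⟩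
  · obtain ⟨P, hP, hPe⟩ := hδ.isSymSection U (fun i ↦ e i ≫ f) fun T g ↦ by
      have h1 : Function.Bijective fun a : T ⟶ A ↦ a ≫ f :=
        ((isIso_iff_yoneda_map_bijective f).1 inferInstance) T
      have h2 := h1.comp (he T g)
      simpa only [Function.comp_def, hsum] using h2
    refine ⟨P, hP, fun T g c ↦ ?_⟩
    rw [value_appTop, hsum, hPe]
  · rw [value_appTop, hf.one_comp, hδ.value_one]
  · rw [value_appTop, value_appTop, value_appTop]
    rcases hf.mul_comp with h | h
    · rw [h, hδ.value_mul]
    · rw [h, hδ.value_mul, mul_comm]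
  · rw [hf.charPoly_appTop hlin, ← cancel_mono f, hf.aeval_comp hlin, hδ.aeval_charPoly]
    exact ((hf.postcomp T).map_zero).symm

end IsAutOrAntiaut

/-- A `𝔾ₐ`-linear ring automorphism or antiautomorphism preserves the determinant. -/
lemma IsAutOrAntiaut.value_comp_eq [IsIntegral S] (hA : IsVectorBundle A n) {k : ℕ}
    (hk : ¬ DegreeLE A k) {δ : Γ(A.left, ⊤)} (hδ : IsDeterminant n (k + 1) δ)
    {f : A ⟶ A} (hf : IsAutOrAntiaut f) (hlin : IsGaLinear f) (T : Over S) (a : T ⟶ A) :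
    value δ (a ≫ f) = value δ a := by
  choose U hxU hU e he using fun x : T.left ↦ exists_frame_isAffineOpen hA (T.hom x)
  have hcov : ⨆ x, T.hom ⁻¹ᵁ U x = ⊤ := top_le_iff.1 fun x _ ↦
      TopologicalSpace.Opens.mem_iSup.2 ⟨x, hxU x⟩
  refine Scheme.OpenCover.ext_elem _ _ (T.left.openCoverOfIsOpenCover _ (.mk hcov))
    fun (x : T.left) ↦ ?_
  change (restrictι T (T.hom ⁻¹ᵁ U x)).left.appTop _ = (restrictι T (T.hom ⁻¹ᵁ U x)).left.appTop _
  obtain ⟨g⟩ := exists_restrict_preimage T (U x)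
  have : Nonempty (U x) := ⟨⟨_, hxU x⟩⟩
  rw [← value_comp, ← value_comp, ← Category.assoc, ← value_appTop]
  exact IsDeterminant.value_eq_value hA hk (hf.isDeterminant_appTop hlin hδ) hδ (hU x) (he x) g _

end Automorphisms

/-! ### Automorphisms preserving the scalars -/

section Scalars

/-- A polynomial `σ` with `σ(XY) = σ(X) σ(Y)` that has a right inverse under composition fixing `0`
is `X`. The first condition says that the coefficients of `σ` are orthogonal idempotents; by the
second, the coefficient of `X` is a unit, as one sees from the derivative at `0`. -/
lemma eq_X_of_multiplicative {R : Type*} [CommRing R] {σ τ : R[X]}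
    (hσ : σ.eval₂ (Polynomial.C.comp Polynomial.C) (Polynomial.C Polynomial.X * Polynomial.X) =
      σ.eval₂ (Polynomial.C.comp Polynomial.C) (Polynomial.C Polynomial.X : R[X][X]) *
        σ.eval₂ (Polynomial.C.comp Polynomial.C) Polynomial.X)
    (hτ : τ.eval 0 = 0) (h : σ.comp τ = Polynomial.X) : σ = Polynomial.X := by
  have key : ∀ i j, (if i = j then σ.coeff j else 0) = σ.coeff i * σ.coeff j := by
    intro i j
    have e1 : σ.eval₂ (Polynomial.C.comp Polynomial.C)
        (Polynomial.C Polynomial.X * Polynomial.X : R[X][X]) =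
        (σ.map Polynomial.C).comp (Polynomial.C Polynomial.X * Polynomial.X) := by
      rw [Polynomial.comp, Polynomial.eval₂_map]
    have e2 : σ.eval₂ (Polynomial.C.comp Polynomial.C) (Polynomial.C Polynomial.X : R[X][X]) =
        Polynomial.C σ := by
      rw [← Polynomial.hom_eval₂, Polynomial.eval₂_C_X]
    have e3 : σ.eval₂ (Polynomial.C.comp Polynomial.C) (Polynomial.X : R[X][X]) =
        σ.map Polynomial.C := rfl
    rw [e1, e2, e3] at hσ
    have := congr((($hσ).coeff j).coeff i)
    rw [Polynomial.comp_C_mul_X_coeff, Polynomial.coeff_C_mul, Polynomial.coeff_map,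
      Polynomial.coeff_C_mul_X_pow, Polynomial.coeff_mul_C] at this
    exact this
  have h1 : σ.coeff 1 = 1 := by
    have h2 := congr((Polynomial.derivative $h).eval 0)
    rw [Polynomial.derivative_comp, Polynomial.derivative_X, Polynomial.eval_mul,
      Polynomial.eval_comp, hτ, Polynomial.eval_one, ← Polynomial.coeff_zero_eq_eval_zero
      (Polynomial.derivative σ), Polynomial.coeff_derivative] at h2
    have h3 := key 1 1
    simp only [zero_add, Nat.cast_zero, mul_one, if_true] at h2 h3
    have hu : IsUnit (σ.coeff 1) := .of_mul_eq_one_right _ h2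
    exact hu.mul_left_cancel (by rw [mul_one, ← h3])
  ext i
  rw [Polynomial.coeff_X]
  have := key 1 i
  rw [h1, one_mul] at this
  rw [← this]
  split_ifs with hi
  · rw [← hi, h1]
  · rfl

variable {S : Scheme.{u}} {A : Over S} [RingObj A] [GaAlgebra A] {n : ℕ}

lemma IsFrameOver.algebraMap_injective {T : Over S} {e : Fin n → (T ⟶ A)}
    (he : IsFrameOver A T e) (hn : n ≠ 0) :
    Function.Injective (algebraMap Γ(T.left, ⊤) (T ⟶ A)) := by
  intro r s h
  have h1 := congr(he.basis.repr ($h * he.basis ⟨0, Nat.pos_of_ne_zero hn⟩)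
    ⟨0, Nat.pos_of_ne_zero hn⟩)
  rw [← Algebra.smul_def, ← Algebra.smul_def] at h1
  simpa only [map_smul, Finsupp.smul_apply, Module.Basis.repr_self, Finsupp.single_eq_same,
    smul_eq_mul, mul_one] using h1

/-- A function `r` on a `T`-scheme is the pullback of the coordinate of the affine line over `T`.
-/
lemma exists_lift_line {T T' : Over S} [IsAffine T.left] (g : T' ⟶ T) (r : Γ(T'.left, ⊤)) :
    ∃ q : T' ⟶ line T, ∀ y,
      q.left.appTop y = (lineFunctions T y).eval₂ g.left.appTop.hom r := by
  obtain ⟨q, -, hq⟩ := exists_lift_specOver (T := T) Polynomial.C g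
    (Polynomial.eval₂RingHom g.left.appTop.hom r) (by simp)
  exact ⟨q, hq⟩

/-- A polynomial is multiplicative on a `Γ(T, ⊤)`-algebra if it is so on the functions on its
spectrum. -/
lemma eval₂_mul_eq_of_specOver {T : Over S} [IsAffine T.left] {Q : Type u} [CommRing Q]
    (φ : Γ(T.left, ⊤) →+* Q) {σ : Γ(T.left, ⊤)[X]}
    (h : ∀ r s, σ.eval₂ (specProj φ).left.appTop.hom (r * s) =
      σ.eval₂ (specProj φ).left.appTop.hom r * σ.eval₂ (specProj φ).left.appTop.hom s) (r s : Q) :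
    σ.eval₂ φ (r * s) = σ.eval₂ φ r * σ.eval₂ φ s := by
  have hφ : (specFunctions φ).toRingHom.comp (specProj φ).left.appTop.hom = φ :=
    RingHom.ext fun y ↦ by
      have := congr(specFunctions φ $(specProj_appTop φ y))
      exact this.trans ((specFunctions φ).apply_symm_apply _)
  have key (r) : (specFunctions φ).toRingHom (σ.eval₂ (specProj φ).left.appTop.hom r) =
      σ.eval₂ φ (specFunctions φ r) := by
    rw [Polynomial.hom_eval₂, hφ]
    rfl
  obtain ⟨r, rfl⟩ := (specFunctions φ).surjective r
  obtain ⟨s, rfl⟩ := (specFunctions φ).surjective s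
  rw [← key, ← key, ← map_mul, ← map_mul, ← key, h]

/-- Over a base where `A` has a nonempty frame, an automorphism that maps the scalars onto the
scalars fixes them: it acts on them through a polynomial `σ`, its value at the coordinate of the
affine line, and `𝔾ₐ` has no ring scheme automorphism other than the identity. -/
lemma IsAutOrAntiaut.algebraMap_comp_of_frame {f : A ⟶ A} (hf : IsAutOrAntiaut f)
    (hs : PreservesScalars f) {T : Over S} [IsAffine T.left] {e : Fin n → (T ⟶ A)}
    (he : IsFrameOver A T e) (hn : n ≠ 0) {T' : Over S} (g : T' ⟶ T)
    (r : Γ(T'.left, ⊤)) : algebraMap _ (T' ⟶ A) r ≫ f = algebraMap _ (T' ⟶ A) r := by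
  have := hf.isIso
  have inj {T' : Over S} (g : T' ⟶ T) := (he.comp g).algebraMap_injective hn
  let x := (lineFunctions T).symm Polynomial.X
  obtain ⟨σ, hσ⟩ := (hs (line T)).le ⟨_, ⟨x, rfl⟩, rfl⟩
  obtain ⟨_, ⟨τ, rfl⟩, hτ⟩ := (hs (line T)).ge ⟨x, rfl⟩
  obtain ⟨σ, rfl⟩ := (lineFunctions T).symm.surjective σ
  obtain ⟨τ, rfl⟩ := (lineFunctions T).symm.surjective τ
  -- `f` acts on all scalars through `σ`, and its inverse through `τ`.
  have hσ' {T' : Over S} (g : T' ⟶ T) (r : Γ(T'.left, ⊤)) :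
      algebraMap _ (T' ⟶ A) r ≫ f = algebraMap _ (T' ⟶ A) (σ.eval₂ g.left.appTop.hom r) := by
    obtain ⟨q, hq⟩ := exists_lift_line g r
    have h1 := congr(q ≫ $hσ)
    dsimp only at h1
    rw [comp_algebraMap, ← Category.assoc, comp_algebraMap, hq, hq] at h1
    simpa [x] using h1.symm
  have hτ' {T' : Over S} (g : T' ⟶ T) (r : Γ(T'.left, ⊤)) :
      algebraMap _ (T' ⟶ A) (τ.eval₂ g.left.appTop.hom r) ≫ f = algebraMap _ (T' ⟶ A) r := by
    obtain ⟨q, hq⟩ := exists_lift_line g r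
    have h1 := congr(q ≫ $hτ)
    dsimp only at h1
    rw [comp_algebraMap, ← Category.assoc, comp_algebraMap, hq, hq] at h1
    simpa [x] using h1
  have hzero : (0 : T ⟶ A) ≫ f = 0 := (hf.postcomp T).map_zero
  have hmul {T' : Over S} (g : T' ⟶ T) (r s : Γ(T'.left, ⊤)) :
      σ.eval₂ g.left.appTop.hom (r * s) =
        σ.eval₂ g.left.appTop.hom r * σ.eval₂ g.left.appTop.hom s := by
    apply inj g
    rw [map_mul, ← hσ', ← hσ', ← hσ', map_mul]
    rcases hf.mul_comp with h | h
    · exact h _ _ _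
    · exact (h _ _ _).trans (by rw [hσ' g, hσ' g, Algebra.commutes])
  have key : σ = Polynomial.X := by
    refine eq_X_of_multiplicative (τ := τ) ?_ ?_ ?_
    · exact eval₂_mul_eq_of_specOver _ (hmul (specProj _)) _ _
    · have h1 := hτ' (𝟙 T) 0
      rw [map_zero, ← hzero, cancel_mono] at h1
      apply inj (𝟙 T)
      rw [map_zero, ← h1]
      rfl
    · apply (lineFunctions T).symm.injective
      apply inj (lineProj T)
      have h1 := hσ' (lineProj T) ((lineFunctions T).symm τ)
      refine Eq.trans ?_ (h1.symm.trans hτ)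
      congr 1
      rw [← RingEquiv.coe_toRingHom, Polynomial.comp, Polynomial.hom_eval₂]
      congr 1
      refine RingHom.ext fun y ↦ (lineFunctions T).injective ?_
      exact ((lineFunctions T).apply_symm_apply _).trans (lineFunctions_lineProj T y).symm
  rw [hσ' g, key, Polynomial.eval₂_X]

/-- A ring automorphism or antiautomorphism that maps the scalars onto the scalars is `𝔾ₐ`-linear.
-/
lemma IsAutOrAntiaut.isGaLinear (hA : IsVectorBundle A n) {f : A ⟶ A} (hf : IsAutOrAntiaut f)
    (hs : PreservesScalars f) : IsGaLinear f := by
  have key (T : Over S) (r : Γ(T.left, ⊤)) :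
      algebraMap _ (T ⟶ A) r ≫ f = algebraMap _ (T ⟶ A) r := by
    choose U hxU hU e he using fun x : T.left ↦ exists_frame_isAffineOpen hA (T.hom x)
    refine hom_ext_of_cover (fun x ↦ T.hom ⁻¹ᵁ U x) (top_le_iff.1 fun x _ ↦
      TopologicalSpace.Opens.mem_iSup.2 ⟨x, hxU x⟩) fun x ↦ ?_
    have : IsAffine (Over.mk (U x).ι).left := hU x
    obtain ⟨g⟩ := exists_restrict_preimage T (U x)
    have he' : IsFrameOver A (Over.mk (U x).ι) (e x) := he x
    -- For `n = 0` scalars do not embed into `A`, but `A` has only one point.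
    obtain rfl | hn := eq_or_ne n 0
    · exact (he'.comp g).basis.ext_elem fun i ↦ i.elim0
    · rw [← Category.assoc, comp_algebraMap, hf.algebraMap_comp_of_frame hs he' hn g]
  intro T r a
  rw [Algebra.smul_def, Algebra.smul_def]
  rcases hf.mul_comp with h | h
  · rw [h, key]
  · rw [h, key, Algebra.commutes]

end Scalars

end AlgScheme

theorem proposition3p3 {S : Scheme.{u}} [IsIntegral S]
    (hS : ∀ x : S, IsIntegrallyClosed (S.presheaf.stalk x))
    (A : Over S) [RingObj A] [AlgScheme.GaAlgebra A]
    (n : ℕ) (hA : AlgScheme.IsVectorBundle A n)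
    (d : ℕ) (hd : 2 ≤ d) (hdeg : IsLeast {m : ℕ | AlgScheme.DegreeLE A m} d)
    (det : Γ(A.left, ⊤)) (hdet : AlgScheme.IsDeterminant n d det)
    (f : A ⟶ A) (hf : AlgScheme.IsRingAut f ∨ AlgScheme.IsRingAntiaut f) :
    (AlgScheme.PreservesScalars f → ∀ (T : Over S) (a : T ⟶ A),
      algebraMap Γ(T.left, ⊤) (T ⟶ A) (AlgScheme.value det (a ≫ f)) =
        algebraMap Γ(T.left, ⊤) (T ⟶ A) (AlgScheme.value det a) ≫ f) ∧
    (AlgScheme.IsGaLinear f → ∀ (T : Over S) (a : T ⟶ A),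
      AlgScheme.value det (a ≫ f) = AlgScheme.value det a) := by
  have hf' : AlgScheme.IsAutOrAntiaut f := hf.elim (·.isAutOrAntiaut) (·.isAutOrAntiaut)
  obtain ⟨k, rfl⟩ : ∃ k, d = k + 1 := ⟨d - 1, by omega⟩
  have hk : ¬ AlgScheme.DegreeLE A k := fun h ↦ Nat.not_succ_le_self k (hdeg.2 h)
  have hb := hf'.value_comp_eq hA hk hdet
  refine ⟨fun hs T a ↦ ?_, hb⟩
  have hlin := hf'.isGaLinear hA hs
  rw [hb hlin, hf'.algebraMap_comp hlin]
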